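/- \textbf{Conventions.} Let $p$ be a prime and $F$ a field of characteristic $p$. Let $J_k=I_k+N_k$ be the $k\times k$ unipotent Jordan block over $F$, where $N_k$ has entries $1$ in the positions $(i,i+1)$ and $0$ elsewhere. For $1\le r\le s$, the Jordan canonical form of $J_r\otimes J_s$ is $J_{\lambda_1}\oplus\cdots\oplus J_{\lambda_r}$ with $\lambda_1\ge\cdots\ge\lambda_r>0$, where the $\lambda_n$ depend only on $r,s,p$; the Norman permutation $\pi(r,s,p)$ of $[r]=\{1,\dots,r\}$ is $n\mapsto (r+1-n)+s-\lambda_n$. For $1\le i\le j\le r$, let $\mathrm{Rev}(i,j)$ be the permutation of $[r]$ that sends $n$ to $i+j-n$ if $i\le n\le j$ and fixes all other points. For $1\le k\le p^N$, let $V_k$ be the indecomposable $k$-dimensional module over $F$ for the cyclic group $C_{p^N}$ of order $p^N$, on which a fixed generator acts as $J_k$. The Green ring of $C_{p^N}$ over $F$ is generated additively by the isomorphism classes of finite-dimensional modules, with $[V]+[W]=[V\oplus W]$ and $[V][W]=[V\otimes W]$. \textbf{Proposition.} Let $r$ be a positive integer whose $p$-part (the largest power of $p$ dividing $r$) is $b$,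 where $1<b<r$, and let $m$ be such that $r\le p^m$. Then \begin{align*} \pi(r,p^m+b,p)&=\mathrm{Rev}(1,b)\,\mathrm{Rev}(b+1,r),\\ \pi(r,p^m+2b,p)&=\mathrm{Rev}(1,b)\,\mathrm{Rev}(b+1,2b)\,\mathrm{Rev}(2b+1,r)\qquad\text{if } 2b<r,\\ \pi(r,p^m+b+1,p)&=\mathrm{Rev}(2,b)\,\mathrm{Rev}(b+2,r). \end{align*} Moreover, for every $N$ with $p^m+r+b\le p^N$, in the Green ring of $C_{p^N}$ over $F$, \[ V_r\otimes V_{p^m+b+1}=V_{p^m+r+b}\oplus(b-1)V_{p^m+r}\oplus V_{p^m+r-b}\oplus(r-b-1)V_{p^m}, \] where $cV$ denotes the direct sum of $c$ copies of $V$. -/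

import Mathlib

open CategoryTheory MonoidalCategory
open scoped Kronecker

/-- The nilpotent Jordan block `N_k`: the `k × k` matrix with `1` in the entries `(i, i + 1)`
and zeros elsewhere. -/
def nilBlock (F : Type*) [Field F] (k : ℕ) : Matrix (Fin k) (Fin k) F :=
  Matrix.of fun i j => if (j : ℕ) = i + 1 then 1 else 0

/-- The unipotent Jordan block `J_k = I_k + N_k`. -/
def jordanBlock (F : Type*) [Field F] (k : ℕ) : Matrix (Fin k) (Fin k) F :=
  1 + nilBlock F k

/-- Similarity of square matrices whose index sets may differ: `P⁻¹ A P = B` for some invertible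
`P` with inverse `Q`. -/
def MatrixSimilar {F : Type*} [Field F] {m n : Type*} [Fintype m] [DecidableEq m]
    [Fintype n] [DecidableEq n] (A : Matrix m m F) (B : Matrix n n F) : Prop :=
  ∃ (P : Matrix m n F) (Q : Matrix n m F), P * Q = 1 ∧ Q * P = 1 ∧ Q * A * P = B

/-- `lam` is a list of `r` positive parts, in weakly decreasing order and indexed by
`[r] = {1, …, r}`, such that the Jordan canonical form of `J_r ⊗ J_s` over `F` is
`J_{lam 1} ⊕ ⋯ ⊕ J_{lam r}`. -/
def IsJordanPartition (F : Type*) [Field F] (r s : ℕ) (lam : Finset.Icc 1 r → ℕ) : Prop :=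
  Antitone lam ∧ (∀ n, 0 < lam n) ∧
    MatrixSimilar (jordanBlock F r ⊗ₖ jordanBlock F s)
      (Matrix.blockDiagonal' fun n => jordanBlock F (lam n))

/-- The Jordan partition `λ(r, s, F)`, with `1 ≤ r ≤ s`. -/
noncomputable def jordanPartition (F : Type*) [Field F] (r s : ℕ) : Finset.Icc 1 r → ℕ :=
  Classical.epsilon (IsJordanPartition F r s)

/-- The Norman permutation `π(r, s, F)` of `[r]`, that is `n ↦ (r + 1 - n) + s - λ_n`. -/
noncomputable def normanPerm (F : Type*) [Field F] (r s : ℕ) : Equiv.Perm (Finset.Icc 1 r) :=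
  Classical.epsilon fun σ : Equiv.Perm (Finset.Icc 1 r) =>
    ∀ n, ((σ n : ℕ) : ℤ) = ((r : ℤ) + 1 - (n : ℕ)) + s - jordanPartition F r s n

/-- The map underlying the reversal `Rev(i, j)`: it sends `n` to `i + j - n` for `i ≤ n ≤ j` and
fixes all other points (it is the identity map unless `1 ≤ i` and `j ≤ r`). -/
def revFun (r i j : ℕ) (n : Finset.Icc 1 r) : Finset.Icc 1 r :=
  if h : 1 ≤ i ∧ j ≤ r ∧ i ≤ (n : ℕ) ∧ (n : ℕ) ≤ j then
    ⟨i + j - n, Finset.mem_Icc.2 (by omega)⟩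
  else n

theorem revFun_involutive (r i j : ℕ) : Function.Involutive (revFun r i j) := by
  intro n
  apply Subtype.ext
  unfold revFun
  split_ifs with h1 h2
  · simp only
    omega
  · exact absurd (by simp only; omega) h2
  · rfl

/-- The reversal permutation `Rev(i, j)` of `[r]`, for `1 ≤ i ≤ j ≤ r`. -/
def Rev (r i j : ℕ) : Equiv.Perm (Finset.Icc 1 r) :=
  (revFun_involutive r i j).toPerm

theorem nilBlock_pow_apply (F : Type*) [Field F] (k t : ℕ) (i j : Fin k) :
    (nilBlock F k ^ t) i j = if (j : ℕ) = i + t then 1 else 0 := by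
  induction t generalizing j with
  | zero => simp [Matrix.one_apply, Fin.ext_iff, eq_comm]
  | succ t ih =>
    rw [pow_succ, Matrix.mul_apply]
    simp only [ih]
    have hN (l : Fin k) : nilBlock F k l j = if (j : ℕ) = l + 1 then 1 else 0 := rfl
    simp only [hN]
    by_cases h : (j : ℕ) = i + (t + 1)
    · have hlt : (i : ℕ) + t < k := by have := j.isLt; omega
      rw [if_pos h, Finset.sum_eq_single ⟨(i : ℕ) + t, hlt⟩]
      · rw [if_pos rfl, if_pos (by simp only; omega), mul_one]
      · intro l _ hl
        rw [if_neg (fun e => hl (Fin.ext e)), zero_mul]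
      · simp
    · rw [if_neg h]
      refine Finset.sum_eq_zero fun l _ => ?_
      by_cases h1 : (l : ℕ) = i + t
      · rw [if_neg (show ¬ (j : ℕ) = l + 1 by omega), mul_zero]
      · rw [if_neg h1, zero_mul]

/-- In characteristic `p` the block `J_k` satisfies `J_k ^ (p ^ N) = 1` once `k ≤ p ^ N`. -/
theorem jordanBlock_pow (F : Type*) [Field F] {p : ℕ} [Fact p.Prime] [CharP F p] {N k : ℕ}
    (hk : k ≤ p ^ N) : jordanBlock F k ^ p ^ N = 1 := by
  have hnil : nilBlock F k ^ p ^ N = 0 := by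
    ext i j
    rw [nilBlock_pow_apply, if_neg (by omega)]
    rfl
  rcases Nat.eq_zero_or_pos k with rfl | hpos
  · exact Subsingleton.elim _ _
  · have : Nonempty (Fin k) := ⟨⟨0, hpos⟩⟩
    rw [jordanBlock, add_pow_char_pow_of_commute (p := p) _ (Commute.one_left _), one_pow, hnil, add_zero]

/-- For a matrix `A` with `A ^ q = 1`, the representation of the cyclic group of order `q` in which
the standard generator acts on column vectors as `A`. -/
def cyclicRep {F : Type*} [Field F] {n : Type*} [Fintype n] [DecidableEq n] {q : ℕ} [NeZero q]
    (A : Matrix n n F) (hA : A ^ q = 1) : Representation F (Multiplicative (ZMod q)) (n → F) where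
  toFun g := Matrix.toLin' (A ^ (Multiplicative.toAdd g).val)
  map_one' := by simp [Module.End.one_eq_id]
  map_mul' g h := by
    rw [toAdd_mul, ZMod.val_add, ← pow_eq_pow_mod _ hA, pow_add, Matrix.toLin'_mul]
    rfl

/-- The indecomposable module `V_k`, for `k ≤ p ^ N`: the module of dimension `k` over a field `F`
of characteristic `p` for the cyclic group of order `p ^ N` whose standard generator acts
as `J_k`. -/
noncomputable def jordanRep (F : Type*) [Field F] {p : ℕ} [Fact p.Prime] [CharP F p] {N : ℕ}
    (k : ℕ) (hk : k ≤ p ^ N) : FDRep F (Multiplicative (ZMod (p ^ N))) :=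
  FDRep.of (cyclicRep (jordanBlock F k) (jordanBlock_pow F hk))

/-- The ideal generated by the elements `[V ⊕ W] - [V] - [W]` in the ring on the free abelian group
of isomorphism classes of finite-dimensional representations, where `[V] * [W] = [V ⊗ W]`. -/
noncomputable def greenIdeal (F G : Type*) [Field F] [Group G] :
    Ideal (MonoidAlgebra ℤ (Skeleton (FDRep F G))) :=
  Ideal.span {x | ∃ (V W : FDRep F G) (B : Limits.BinaryBicone V W), Nonempty B.IsBilimit ∧
    x = MonoidAlgebra.of ℤ _ (toSkeleton B.pt)
      - MonoidAlgebra.of ℤ _ (toSkeleton V) - MonoidAlgebra.of ℤ _ (toSkeleton W)}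

/-- The Green ring (representation ring) of `G` over `F`: isomorphism classes of finite-dimensional
representations, addition induced by direct sums and multiplication by tensor products. -/
abbrev GreenRing (F G : Type*) [Field F] [Group G] : Type _ :=
  MonoidAlgebra ℤ (Skeleton (FDRep F G)) ⧸ greenIdeal F G

/-- The class of a representation in the Green ring. -/
noncomputable def greenClass {F G : Type*} [Field F] [Group G] (V : FDRep F G) : GreenRing F G :=
  Ideal.Quotient.mk (greenIdeal F G) (MonoidAlgebra.of ℤ _ (toSkeleton V))

/-! Write `J_r ⊗ J_s - 1 = z = x + y` with `x = N_r ⊗ 1` and `y = J_r ⊗ N_s`. These commute, `x ^ r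
= 0`, `y ^ s = 0`, and the last basis vector generates the space over `F[x, y]`. If `w_1, …, w_r`
satisfy `w_n ≡ x ^ (n - 1)` mod `z` and `z ^ λ_n * w_n = 0`, then Nakayama's lemma shows that the
`z`-chains of the `w_n` span. If moreover `∑ λ_n = r * s`, they form a Jordan basis
(`IsJordanPartition.of_generators`). The sum condition is automatic once `n ↦ (r + 1 - n) + s - λ_n`
is a permutation.

It remains to find the `w_n`. Put `q = p ^ m`, `r = b * k`, `X = x ^ b`, `Y = y ^ b`, so that `X ^ k
= 0`, `z ^ q = y ^ q` and `z ^ b = X + Y`. Expanding powers of `X + Y` modulo `Y ^ 2` shows that `z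
^ (q + r)` is divisible by `y ^ (q + b)`, while `z ^ (q + r + b)` and `z ^ (q + r - b) * (X - (k -
1) * Y)` are divisible by `y ^ (q + 2 * b)`. Since `y ≡ -x` and `X - (k - 1) * Y ≡ k * X` mod `z`,
and `p ∤ k`, suitable `w_n` are powers of `-y`, or such powers times `(X - (k - 1) * Y) / k`.

Ranks of powers of `A - 1` make the Jordan partition unique, which pins down `jordanPartition` and
`normanPerm`. The Green ring identity follows by turning the Jordan basis into a biproduct
decomposition. -/

open scoped Matrix

universe u

/-! ### Similarity and its rank invariants -/

section Similarity

variable {F : Type*} [Field F] {l m n : Type*} [Fintype l] [DecidableEq l] [Fintype m]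
  [DecidableEq m] [Fintype n] [DecidableEq n]

theorem MatrixSimilar.symm {A : Matrix m m F} {B : Matrix n n F} (h : MatrixSimilar A B) :
    MatrixSimilar B A := by
  obtain ⟨P, Q, h1, h2, rfl⟩ := h
  refine ⟨Q, P, h2, h1, ?_⟩
  calc P * (Q * A * P) * Q = (P * Q) * A * (P * Q) := by simp only [Matrix.mul_assoc]
    _ = A := by rw [h1, Matrix.one_mul, Matrix.mul_one]

theorem MatrixSimilar.trans {A : Matrix l l F} {B : Matrix m m F} {C : Matrix n n F}
    (h : MatrixSimilar A B) (h' : MatrixSimilar B C) : MatrixSimilar A C := by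
  obtain ⟨P, Q, h1, h2, rfl⟩ := h
  obtain ⟨P', Q', h1', h2', rfl⟩ := h'
  refine ⟨P * P', Q' * Q, ?_, ?_, by simp only [Matrix.mul_assoc]⟩
  · calc P * P' * (Q' * Q) = P * (P' * Q') * Q := by simp only [Matrix.mul_assoc]
      _ = 1 := by rw [h1', Matrix.mul_one, h1]
  · calc Q' * Q * (P * P') = Q' * (Q * P) * P' := by simp only [Matrix.mul_assoc]
      _ = 1 := by rw [h2, Matrix.mul_one, h2']

theorem MatrixSimilar.rank_sub_one_pow_le {A : Matrix m m F} {B : Matrix n n F}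
    (h : MatrixSimilar A B) (t : ℕ) : ((B - 1) ^ t).rank ≤ ((A - 1) ^ t).rank := by
  obtain ⟨P, Q, h1, h2, rfl⟩ := h
  have key : ∀ t : ℕ, (Q * A * P - 1) ^ t = Q * (A - 1) ^ t * P := by
    intro t
    induction t with
    | zero => rw [pow_zero, pow_zero, Matrix.mul_one, h2]
    | succ t ih =>
      have : Q * A * P - 1 = Q * (A - 1) * P := by
        rw [Matrix.mul_sub, Matrix.sub_mul, Matrix.mul_one, h2]
      rw [pow_succ, ih, this, pow_succ]
      calc Q * (A - 1) ^ t * P * (Q * (A - 1) * P)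
          = Q * (A - 1) ^ t * (P * Q) * ((A - 1) * P) := by simp only [Matrix.mul_assoc]
        _ = _ := by rw [h1, Matrix.mul_one]; simp only [Matrix.mul_assoc]
  rw [key]
  exact (Matrix.rank_mul_le_left _ _).trans (Matrix.rank_mul_le_right _ _)

theorem MatrixSimilar.rank_sub_one_pow_eq {A : Matrix m m F} {B : Matrix n n F}
    (h : MatrixSimilar A B) (t : ℕ) : ((A - 1) ^ t).rank = ((B - 1) ^ t).rank :=
  le_antisymm (h.symm.rank_sub_one_pow_le t) (h.rank_sub_one_pow_le t)

end Similarity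

/-! ### Uniqueness of the Jordan partition -/

section Uniqueness

variable (F : Type*) [Field F] {ι : Type*} [DecidableEq ι]

theorem blockDiagonal'_jordanBlock_sub_one (lam : ι → ℕ) :
    (Matrix.blockDiagonal' fun n => jordanBlock F (lam n)) - 1 =
      Matrix.blockDiagonal' fun n => nilBlock F (lam n) := by
  rw [← Matrix.blockDiagonal'_one, ← Matrix.blockDiagonal'_sub]
  congr 1
  funext n
  simp [jordanBlock]

/-- Blockwise, `N ^ t` times its transpose is a 0/1 diagonal matrix `D`, and `D * N ^ t = N ^ t`.
Each of `N ^ t` and `D` is thus a left factor of the other, so their ranks agree. -/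
theorem rank_blockDiagonal'_nilBlock_pow [Fintype ι] (lam : ι → ℕ) (t : ℕ) :
    ((Matrix.blockDiagonal' fun n => nilBlock F (lam n)) ^ t).rank =
      ∑ n, (lam n - t) := by
  have hD : ∀ n, nilBlock F (lam n) ^ t * (nilBlock F (lam n) ^ t).transpose =
      Matrix.diagonal fun i : Fin (lam n) => if (i : ℕ) + t < lam n then (1 : F) else 0 := by
    intro n
    ext i j
    simp only [Matrix.mul_apply, Matrix.transpose_apply, nilBlock_pow_apply, Matrix.diagonal_apply]
    split_ifs with h1 h2
    · subst h1
      rw [Finset.sum_eq_single ⟨(i : ℕ) + t, h2⟩]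
      · simp
      · intro l _ hl
        rw [if_neg (fun e => hl (Fin.ext e)), zero_mul]
      · simp
    · refine Finset.sum_eq_zero fun l _ => ?_
      rw [if_neg (by omega), zero_mul]
    · refine Finset.sum_eq_zero fun l _ => ?_
      by_cases h : (l : ℕ) = i + t
      · rw [if_neg (c := (l : ℕ) = j + t) (fun h' => h1 (Fin.ext (by omega))), mul_zero]
      · rw [if_neg h, zero_mul]
  have hE : ∀ n, (Matrix.diagonal fun i : Fin (lam n) =>
      if (i : ℕ) + t < lam n then (1 : F) else 0) * nilBlock F (lam n) ^ t =
        nilBlock F (lam n) ^ t := by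
    intro n
    ext i j
    rw [Matrix.diagonal_mul, nilBlock_pow_apply]
    split_ifs <;> first | (simp; done) | (exfalso; omega)
  have hr : ((Matrix.blockDiagonal' fun n => nilBlock F (lam n)) ^ t).rank =
      (Matrix.diagonal fun x : Σ n, Fin (lam n) =>
        if (x.2 : ℕ) + t < lam x.1 then (1 : F) else 0).rank := by
    rw [← Matrix.blockDiagonal'_pow, ← Matrix.blockDiagonal'_diagonal
      (fun (n : ι) (i : Fin (lam n)) => if (i : ℕ) + t < lam n then (1 : F) else 0)]
    apply le_antisymm
    · conv_lhs => rw [show ((fun n => nilBlock F (lam n)) ^ t) = fun n =>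
        (Matrix.diagonal fun i : Fin (lam n) => if (i : ℕ) + t < lam n then (1 : F) else 0) *
          nilBlock F (lam n) ^ t from funext fun n => (hE n).symm]
      rw [Matrix.blockDiagonal'_mul]
      exact Matrix.rank_mul_le_left _ _
    · simp only [← hD]
      rw [Matrix.blockDiagonal'_mul]
      exact Matrix.rank_mul_le_left _ _
  classical
  rw [hr, Matrix.rank_diagonal]
  have e : {x : Σ n, Fin (lam n) // (if (x.2 : ℕ) + t < lam x.1 then (1 : F) else 0) ≠ 0} ≃
      Σ n, Fin (lam n - t) :=
    { toFun := fun x => ⟨x.1.1, ⟨x.1.2, by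
        have := x.2
        simp only [ne_eq, ite_eq_right_iff, one_ne_zero, imp_false, not_not] at this
        omega⟩⟩
      invFun := fun x => ⟨⟨x.1, ⟨x.2, by have := x.2.2; omega⟩⟩, by
        have := x.2.2
        simp only [ne_eq, ite_eq_right_iff, one_ne_zero, imp_false, not_not]
        omega⟩
      left_inv := fun x => rfl
      right_inv := fun x => rfl }
  rw [Fintype.card_congr e]
  simp

end Uniqueness

/-- Successive differences of the sums count the parts exceeding `t`, that is, they give the
conjugate partition, which determines a weakly decreasing sequence. -/
theorem Antitone.eq_of_forall_sum_tsub_eq {ι : Type*} [Fintype ι] [LinearOrder ι] {f g : ι → ℕ}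
    (hf : Antitone f) (hg : Antitone g) (h : ∀ t, ∑ n, (f n - t) = ∑ n, (g n - t)) : f = g := by
  have hc : ∀ (f : ι → ℕ) (t : ℕ),
      ∑ n, (f n - t) = ∑ n, (f n - (t + 1)) + (Finset.univ.filter fun n => t < f n).card := by
    intro f t
    rw [Finset.card_filter, ← Finset.sum_add_distrib]
    refine Finset.sum_congr rfl fun n _ => ?_
    split_ifs <;> omega
  have hcard : ∀ t, (Finset.univ.filter fun n => t < f n).card =
      (Finset.univ.filter fun n => t < g n).card := by
    intro t
    have h1 := hc f t
    have h2 := hc g t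
    rw [h t, h (t + 1)] at h1
    omega
  have aux : ∀ {f g : ι → ℕ}, Antitone f → Antitone g →
      (∀ t, (Finset.univ.filter fun n => t < f n).card =
        (Finset.univ.filter fun n => t < g n).card) → ∀ n, f n ≤ g n := by
    intro f g hf hg hcard n
    by_contra! hn
    -- If `g n < f n`, take the level `t = g n`: any `k` with `t < g k` lies before `n`, so `t < f
    -- k`, while `n` itself only counts for `f`.
    refine (hcard (g n)).not_gt (Finset.card_lt_card ?_)
    rw [Finset.ssubset_iff_of_subset]
    · exact ⟨n, by simpa using hn, by simp⟩
    · intro k hk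
      simp only [Finset.mem_filter, Finset.mem_univ, true_and] at hk ⊢
      have : k ≤ n := by
        by_contra! hnk
        exact absurd (hg hnk.le) (by omega)
      exact hn.trans_le (hf this)
  exact funext fun n => le_antisymm (aux hf hg hcard n) (aux hg hf (fun t => (hcard t).symm) n)

theorem IsJordanPartition.unique {F : Type*} [Field F] {r s : ℕ} {lam lam' : Finset.Icc 1 r → ℕ}
    (h : IsJordanPartition F r s lam) (h' : IsJordanPartition F r s lam') : lam = lam' := by
  refine h.1.eq_of_forall_sum_tsub_eq h'.1 fun t => ?_
  have := (h.2.2.symm.trans h'.2.2).rank_sub_one_pow_eq t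
  rwa [blockDiagonal'_jordanBlock_sub_one, blockDiagonal'_jordanBlock_sub_one,
    rank_blockDiagonal'_nilBlock_pow, rank_blockDiagonal'_nilBlock_pow] at this

theorem IsJordanPartition.jordanPartition_eq {F : Type*} [Field F] {r s : ℕ}
    {lam : Finset.Icc 1 r → ℕ} (h : IsJordanPartition F r s lam) :
    jordanPartition F r s = lam :=
  IsJordanPartition.unique (Classical.epsilon_spec (p := IsJordanPartition F r s) ⟨lam, h⟩) h

theorem IsJordanPartition.normanPerm_eq {F : Type*} [Field F] {r s : ℕ}
    {lam : Finset.Icc 1 r → ℕ} (h : IsJordanPartition F r s lam)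
    {σ : Equiv.Perm (Finset.Icc 1 r)}
    (hσ : ∀ n, ((σ n : ℕ) : ℤ) = ((r : ℤ) + 1 - (n : ℕ)) + s - lam n) :
    normanPerm F r s = σ := by
  have hs := Classical.epsilon_spec
    (p := fun σ : Equiv.Perm (Finset.Icc 1 r) =>
      ∀ n, ((σ n : ℕ) : ℤ) = ((r : ℤ) + 1 - (n : ℕ)) + s - jordanPartition F r s n)
    ⟨σ, by rwa [h.jordanPartition_eq]⟩
  ext n
  have h1 : ((normanPerm F r s n : ℕ) : ℤ) = _ := hs n
  rw [h.jordanPartition_eq, ← hσ n] at h1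
  exact_mod_cast h1

/-! ### Generation modulo the image of a nilpotent map, and Jordan chains -/

section Chains

variable {F : Type*} [Field F] {V : Type*} [AddCommGroup V] [Module F V]

/-- A form of Nakayama's lemma for a nilpotent endomorphism. -/
theorem Submodule.eq_top_of_sup_range_eq_top {z : Module.End F V} (hz : IsNilpotent z)
    {W : Submodule F V} (hW : W.map z ≤ W) (h : W ⊔ LinearMap.range z = ⊤) : W = ⊤ := by
  have key : ∀ t : ℕ, W ⊔ LinearMap.range (z ^ t) = ⊤ := by
    intro t
    induction t with
    | zero => simp [Module.End.one_eq_id]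
    | succ t ih =>
      have h1 : LinearMap.range z ≤ W ⊔ LinearMap.range (z ^ (t + 1)) := by
        -- Applying `z` to `W + z ^ t V = V` gives `z V ≤ W + z ^ (t + 1) V`.
        rw [LinearMap.range_eq_map, ← ih, Submodule.map_sup]
        refine sup_le_sup hW ?_
        rw [← LinearMap.range_comp, pow_succ']
        exact le_rfl
      rw [eq_top_iff, ← h]
      exact sup_le le_sup_left h1
  obtain ⟨t, ht⟩ := hz
  simpa [ht] using key t

/-- Applying `x ^ i` to the hypothesis expresses the range of `x ^ i` through `x ^ i v`, the range
of `x ^ (i + 1)` and the range of `z`. Descend from `i = r`, where `x ^ r = 0`, to `i = 0`. -/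
theorem Module.End.span_pow_apply_sup_range_eq_top {x z : Module.End F V} (hxz : Commute x z)
    {r : ℕ} (hx : x ^ r = 0) {v : V}
    (hv : Submodule.span F {v} ⊔ LinearMap.range x ⊔ LinearMap.range z = ⊤) :
    Submodule.span F (Set.range fun i : Fin r => (x ^ (i : ℕ)) v) ⊔ LinearMap.range z = ⊤ := by
  set S := Submodule.span F (Set.range fun i : Fin r => (x ^ (i : ℕ)) v) ⊔ LinearMap.range z
  have key : ∀ t i : ℕ, i + t = r → LinearMap.range (x ^ i) ≤ S := by
    intro t
    induction t with
    | zero =>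
      intro i hi
      obtain rfl : i = r := by omega
      simp [hx]
    | succ t ih =>
      intro i hi
      rw [LinearMap.range_eq_map, ← hv, Submodule.map_sup, Submodule.map_sup]
      refine sup_le (sup_le ?_ ?_) ?_
      · rw [Submodule.map_span, Set.image_singleton]
        refine le_trans (Submodule.span_mono ?_) le_sup_left
        rintro _ rfl
        exact ⟨⟨i, by omega⟩, rfl⟩
      · rw [← LinearMap.range_comp]
        refine le_trans (le_of_eq ?_) (ih (i + 1) (by omega))
        rw [pow_succ]
        rfl
      · rw [← LinearMap.range_comp]
        refine le_trans ?_ le_sup_right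
        have : (x ^ i) ∘ₗ z = z ∘ₗ (x ^ i) := (hxz.pow_left i).eq
        rw [this]
        exact LinearMap.range_comp_le_range _ _
  have := key r 0 (by omega)
  rw [pow_zero, Module.End.one_eq_id, LinearMap.range_id] at this
  exact top_le_iff.1 this

end Chains

/-- The chains `z ^ i *ᵥ w n` with `i < lam n` span by Nakayama's lemma. There are as many of them
as the dimension, so they form a basis. -/
theorem matrixSimilar_blockDiagonal'_jordanBlock {F : Type*} [Field F] {m ι : Type*} [Fintype m]
    [DecidableEq m] [Fintype ι] [DecidableEq ι] {A : Matrix m m F} (hA : IsNilpotent (A - 1))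
    {lam : ι → ℕ} (hcard : Fintype.card m = ∑ n, lam n) (w : ι → m → F)
    (hw : ∀ n, (A - 1) ^ lam n *ᵥ w n = 0)
    (hspan : Submodule.span F (Set.range w) ⊔ LinearMap.range (Matrix.toLin' (A - 1)) = ⊤) :
    MatrixSimilar A (Matrix.blockDiagonal' fun n => jordanBlock F (lam n)) := by
  set z := A - 1 with hzdef
  -- The chains are listed in reverse: `N_k` has its ones above the diagonal, so `z` must send
  -- column `j` to column `j - 1` and kill column `0`.
  let P : Matrix m (Σ n, Fin (lam n)) F :=
    Matrix.of fun i x => (z ^ (lam x.1 - 1 - x.2) *ᵥ w x.1) i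
  have hcol : ∀ x, P.col x = z ^ (lam x.1 - 1 - x.2) *ᵥ w x.1 := fun x => rfl
  have hzP : z * P = P * Matrix.blockDiagonal' fun n => nilBlock F (lam n) := by
    ext i ⟨n, j⟩
    rw [Matrix.mul_apply, Matrix.mul_apply, Fintype.sum_sigma, Finset.sum_eq_single n]
    · have h1 : ∑ k, z i k * P k ⟨n, j⟩ = (z ^ (lam n - j) *ᵥ w n) i := by
        have : lam n - j = (lam n - 1 - j) + 1 := by have := j.2; omega
        rw [this, pow_succ', ← Matrix.mulVec_mulVec]
        rfl
      rw [h1]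
      simp only [Matrix.blockDiagonal'_apply_eq]
      by_cases hj : (j : ℕ) = 0
      · rw [Finset.sum_eq_zero, hj, Nat.sub_zero, hw]
        · rfl
        · intro k _
          have : nilBlock F (lam n) k j = 0 := if_neg (by omega)
          rw [this, mul_zero]
      · rw [Finset.sum_eq_single ⟨(j : ℕ) - 1, by have := j.2; omega⟩]
        · have : nilBlock F (lam n) ⟨(j : ℕ) - 1, by have := j.2; omega⟩ j = 1 :=
            if_pos (by simp only; omega)
          rw [this, mul_one]
          have e : lam n - j = lam n - 1 - (j - 1) := by have := j.2; omega
          rw [e]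
          rfl
        · intro k _ hk
          have : nilBlock F (lam n) k j = 0 := if_neg fun e => hk (Fin.ext (by simp only; omega))
          rw [this, mul_zero]
        · simp
    · intro n' _ hn
      refine Finset.sum_eq_zero fun k _ => ?_
      rw [Matrix.blockDiagonal'_apply_ne _ _ _ hn, mul_zero]
    · simp
  have hsurj : LinearMap.range P.mulVecLin = ⊤ := by
    refine Submodule.eq_top_of_sup_range_eq_top (z := Matrix.toLin' z) ?_ ?_ ?_
    · obtain ⟨t, ht⟩ := hA
      exact ⟨t, by rw [← Matrix.toLin'_pow, ht, map_zero]⟩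
    · rintro _ ⟨_, ⟨u, rfl⟩, rfl⟩
      refine ⟨(Matrix.blockDiagonal' fun n => nilBlock F (lam n)) *ᵥ u, ?_⟩
      simp only [Matrix.mulVecLin_apply, Matrix.toLin'_apply, Matrix.mulVec_mulVec, hzP]
    · rw [eq_top_iff, ← hspan]
      refine sup_le_sup_right (Submodule.span_le.2 ?_) _
      rintro _ ⟨n, rfl⟩
      rw [Matrix.range_mulVecLin]
      rcases Nat.eq_zero_or_pos (lam n) with h0 | hpos
      · have := hw n
        rw [h0, pow_zero, Matrix.one_mulVec] at this
        rw [this]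
        exact zero_mem _
      · refine Submodule.subset_span ⟨⟨n, ⟨lam n - 1, by omega⟩⟩, ?_⟩
        rw [hcol]
        simp
  obtain ⟨Q, hPQ⟩ := Matrix.mulVec_surjective_iff_exists_right_inverse.1
    (LinearMap.range_eq_top.1 hsurj)
  have hQP : Q * P = 1 :=
    (Matrix.mul_eq_one_comm_of_card_eq _ _ _ (by simp [hcard])).1 hPQ
  refine ⟨P, Q, hPQ, hQP, ?_⟩
  have hA' : A = z + 1 := by rw [hzdef, sub_add_cancel]
  have hB := blockDiagonal'_jordanBlock_sub_one F lam
  rw [sub_eq_iff_eq_add] at hB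
  rw [hB, hA', Matrix.mul_add, Matrix.add_mul, Matrix.mul_one, hQP, Matrix.mul_assoc, hzP,
    ← Matrix.mul_assoc, hQP, Matrix.one_mul]

open scoped IsMulCommutative in
/-- Two commuting elements of a ring are the images of elements of a commutative ring. -/
theorem Commute.exists_commRing_lift {A : Type u} [Ring A] (p : ℕ) [CharP A p] {a b : A}
    (h : Commute a b) : ∃ (R : Type u) (_ : CommRing R) (_ : CharP R p) (f : R →+* A) (x y : R),
      Function.Injective f ∧ f x = a ∧ f y = b := by
  have hcomm : ∀ c ∈ ({a, b} : Set A), ∀ d ∈ ({a, b} : Set A), c * d = d * c := by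
    rintro c (rfl | rfl) d (rfl | rfl)
    exacts [rfl, h.eq, h.eq.symm, rfl]
  have := Algebra.isMulCommutative_adjoin ℤ hcomm
  exact ⟨Algebra.adjoin ℤ {a, b}, inferInstance,
    (Algebra.adjoin ℤ {a, b}).val.toRingHom.charP Subtype.val_injective p,
    (Algebra.adjoin ℤ {a, b}).val.toRingHom, ⟨a, Algebra.subset_adjoin (by simp)⟩,
    ⟨b, Algebra.subset_adjoin (by simp)⟩, Subtype.val_injective, rfl, rfl⟩

/-! ### The Kronecker product as a module over two commuting nilpotents -/

section Kronecker

variable (F : Type u) [Field F] (r s : ℕ)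

theorem nilBlock_pow_self : nilBlock F r ^ r = 0 := by
  ext i j
  rw [nilBlock_pow_apply, if_neg (by omega)]
  rfl

theorem kronecker_pow {m n : Type*} [Fintype m] [DecidableEq m] [Fintype n] [DecidableEq n]
    (A : Matrix m m F) (B : Matrix n n F) (t : ℕ) : (A ⊗ₖ B) ^ t = (A ^ t) ⊗ₖ (B ^ t) := by
  induction t with
  | zero => simp
  | succ t ih => rw [pow_succ, ih, ← Matrix.mul_kronecker_mul, pow_succ, pow_succ]

theorem jordanBlock_kronecker_sub_one :
    jordanBlock F r ⊗ₖ jordanBlock F s - 1 =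
      nilBlock F r ⊗ₖ (1 : Matrix (Fin s) (Fin s) F) + jordanBlock F r ⊗ₖ nilBlock F s := by
  have : jordanBlock F r ⊗ₖ jordanBlock F s =
      jordanBlock F r ⊗ₖ (1 : Matrix (Fin s) (Fin s) F) + jordanBlock F r ⊗ₖ nilBlock F s := by
    rw [← Matrix.kronecker_add]
    rfl
  rw [this, jordanBlock, Matrix.add_kronecker, Matrix.one_kronecker_one]
  abel

theorem commute_nilBlock_kronecker :
    Commute (nilBlock F r ⊗ₖ (1 : Matrix (Fin s) (Fin s) F))
      (jordanBlock F r ⊗ₖ nilBlock F s) := by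
  rw [Commute, SemiconjBy, ← Matrix.mul_kronecker_mul, ← Matrix.mul_kronecker_mul, jordanBlock,
    mul_add, add_mul, one_mul, mul_one, one_mul, mul_one]

theorem span_single_sup_range_sup_range (hr : 0 < r) (hs : 0 < s) :
    Submodule.span F {(Pi.single (⟨r - 1, by omega⟩, ⟨s - 1, by omega⟩) 1 : Fin r × Fin s → F)} ⊔
      LinearMap.range (Matrix.toLin' (nilBlock F r ⊗ₖ (1 : Matrix (Fin s) (Fin s) F))) ⊔
      LinearMap.range (Matrix.toLin' (jordanBlock F r ⊗ₖ jordanBlock F s - 1)) = ⊤ := by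
  set X := nilBlock F r ⊗ₖ (1 : Matrix (Fin s) (Fin s) F) with hX
  set Z := jordanBlock F r ⊗ₖ jordanBlock F s - 1 with hZ
  set M := (1 : Matrix (Fin r) (Fin r) F) ⊗ₖ nilBlock F s with hM
  have hZX : Z = X + (M + X * M) := by
    rw [hZ, jordanBlock_kronecker_sub_one, jordanBlock, Matrix.add_kronecker, hX, hM,
      ← Matrix.mul_kronecker_mul, Matrix.mul_one, Matrix.one_mul]
  rw [eq_top_iff, ← (Pi.basisFun F (Fin r × Fin s)).span_eq, Submodule.span_le]
  rintro _ ⟨⟨i, j⟩, rfl⟩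
  rw [Pi.basisFun_apply]
  by_cases hi : (i : ℕ) + 1 < r
  · have : X *ᵥ Pi.single (⟨i + 1, hi⟩, j) 1 = Pi.single (i, j) 1 := by
      rw [Matrix.mulVec_single_one]
      ext ⟨i', j'⟩
      simp only [hX, Matrix.col_apply, Matrix.kroneckerMap_apply, nilBlock, Matrix.of_apply,
        Matrix.one_apply, Pi.single_apply, Prod.mk.injEq, Fin.ext_iff]
      split_ifs <;> first | (simp; done) | (exfalso; omega)
    exact Submodule.mem_sup_left (Submodule.mem_sup_right ⟨_, this⟩)
  by_cases hj : (j : ℕ) + 1 < s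
  · have : M *ᵥ Pi.single (i, ⟨j + 1, hj⟩) 1 = Pi.single (i, j) 1 := by
      rw [Matrix.mulVec_single_one]
      ext ⟨i', j'⟩
      simp only [hM, Matrix.col_apply, Matrix.kroneckerMap_apply, nilBlock, Matrix.of_apply,
        Matrix.one_apply, Pi.single_apply, Prod.mk.injEq, Fin.ext_iff]
      split_ifs <;> first | (simp; done) | (exfalso; omega)
    rw [← this]
    set e : Fin r × Fin s → F := Pi.single (i, ⟨j + 1, hj⟩) 1
    -- Since `Z = X + M + X * M`, the range of `M` lies in the sum of the ranges of `X` and `Z`.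
    have : M *ᵥ e = X *ᵥ (-(e + M *ᵥ e)) + Z *ᵥ e := by
      rw [hZX]
      simp only [Matrix.add_mulVec, Matrix.mulVec_neg, Matrix.mulVec_add, Matrix.mulVec_mulVec]
      abel
    rw [this]
    exact Submodule.add_mem_sup (Submodule.mem_sup_right ⟨_, rfl⟩) ⟨_, rfl⟩
  · have hi' : i = ⟨r - 1, by omega⟩ := Fin.ext (by simp only; omega)
    have hj' : j = ⟨s - 1, by omega⟩ := Fin.ext (by simp only; omega)
    rw [hi', hj']
    exact Submodule.mem_sup_left (Submodule.mem_sup_left (Submodule.mem_span_singleton_self _))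

end Kronecker

/-- Generators `w` of the cyclic summands of `F[x, y] / (x ^ r, y ^ s)`, on which `x + y` acts,
give the Jordan partition of `J_r ⊗ J_s`. -/
theorem IsJordanPartition.of_generators {F : Type u} [Field F] {p : ℕ} [CharP F p] {r s : ℕ}
    (hr : 0 < r) (hs : 0 < s) {lam : Finset.Icc 1 r → ℕ} (hanti : Antitone lam)
    (hpos : ∀ n, 0 < lam n) (hsum : ∑ n, lam n = r * s)
    (h : ∀ (R : Type u) [CommRing R] [CharP R p] (x y : R), x ^ r = 0 → y ^ s = 0 →
      ∀ n : Finset.Icc 1 r, ∃ w v : R, x ^ ((n : ℕ) - 1) = w + (x + y) * v ∧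
        (x + y) ^ lam n * w = 0) :
    IsJordanPartition F r s lam := by
  refine ⟨hanti, hpos, ?_⟩
  have : Nonempty (Fin r × Fin s) := ⟨⟨⟨0, hr⟩, ⟨0, hs⟩⟩⟩
  set X := nilBlock F r ⊗ₖ (1 : Matrix (Fin s) (Fin s) F) with hX
  set Y := jordanBlock F r ⊗ₖ nilBlock F s with hY
  set Z := jordanBlock F r ⊗ₖ jordanBlock F s - 1 with hZ
  have hXr : X ^ r = 0 := by
    rw [hX, kronecker_pow, nilBlock_pow_self, Matrix.zero_kronecker]
  have hYs : Y ^ s = 0 := by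
    rw [hY, kronecker_pow, nilBlock_pow_self, Matrix.kronecker_zero]
  have hXY : Commute X Y := commute_nilBlock_kronecker F r s
  have hZXY : Z = X + Y := jordanBlock_kronecker_sub_one F r s
  -- Injectivity of `f` carries the relations `X ^ r = 0` and `Y ^ s = 0` back to `R`, where the
  -- hypothesis `h` on commutative rings applies.
  obtain ⟨R, _, _, f, x, y, hf, hx, hy⟩ := hXY.exists_commRing_lift p
  have hxr : x ^ r = 0 := hf (by rw [map_pow, hx, hXr, map_zero])
  have hys : y ^ s = 0 := hf (by rw [map_pow, hy, hYs, map_zero])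
  choose w v hwv hw using h R x y hxr hys
  have hfz : f (x + y) = Z := by rw [map_add, hx, hy, hZXY]
  set e : Fin r × Fin s → F := Pi.single (⟨r - 1, by omega⟩, ⟨s - 1, by omega⟩) 1
  refine matrixSimilar_blockDiagonal'_jordanBlock ?_ (by simpa using hsum.symm)
    (fun n => f (w n) *ᵥ e) ?_ ?_
  · change IsNilpotent Z
    rw [hZXY]
    exact hXY.isNilpotent_add ⟨r, hXr⟩ ⟨s, hYs⟩
  · intro n
    change Z ^ lam n *ᵥ (f (w n) *ᵥ e) = 0
    rw [Matrix.mulVec_mulVec, ← hfz, ← map_pow, ← map_mul, hw, map_zero, Matrix.zero_mulVec]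
  · have hcomm : Commute (Matrix.toLin' X) (Matrix.toLin' Z) := by
      rw [Commute, SemiconjBy, Module.End.mul_eq_comp, Module.End.mul_eq_comp,
        ← Matrix.toLin'_mul, ← Matrix.toLin'_mul, hZXY, mul_add, add_mul, hXY.eq]
    have hX' : Matrix.toLin' X ^ r = 0 := by rw [← Matrix.toLin'_pow, hXr, map_zero]
    have hspan := Module.End.span_pow_apply_sup_range_eq_top hcomm hX'
      (span_single_sup_range_sup_range F r s hr hs)
    rw [eq_top_iff, ← hspan]
    refine sup_le (Submodule.span_le.2 ?_) le_sup_right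
    rintro _ ⟨i, rfl⟩
    have hi := congrArg (fun a => f a *ᵥ e)
      (hwv ⟨i + 1, Finset.mem_Icc.2 ⟨by omega, by have := i.2; omega⟩⟩)
    simp only [Nat.add_sub_cancel, map_pow, hx, map_add, map_mul, hy, ← hZXY,
      Matrix.add_mulVec] at hi
    simp only
    rw [← Matrix.toLin'_pow, Matrix.toLin'_apply, hi, ← Matrix.mulVec_mulVec]
    exact Submodule.add_mem_sup (Submodule.subset_span ⟨_, rfl⟩) ⟨_, rfl⟩

/-- Both `σ n` and `r + 1 - n` run over `[r]`, so summing `hσ` over `n` cancels them and leaves `r *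
s = ∑ lam n`. -/
theorem sum_eq_mul_of_normanPerm {r s : ℕ} (lam : Finset.Icc 1 r → ℕ)
    (σ : Equiv.Perm (Finset.Icc 1 r))
    (hσ : ∀ n, ((σ n : ℕ) : ℤ) = ((r : ℤ) + 1 - (n : ℕ)) + s - lam n) :
    ∑ n, lam n = r * s := by
  have h1 : ∑ n, ((σ n : ℕ) : ℤ) = ∑ n : Finset.Icc 1 r, ((n : ℕ) : ℤ) :=
    Equiv.sum_comp σ fun n => ((n : ℕ) : ℤ)
  have h2 : ∑ n, ((Rev r 1 r n : ℕ) : ℤ) = ∑ n : Finset.Icc 1 r, ((n : ℕ) : ℤ) :=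
    Equiv.sum_comp (Rev r 1 r) fun n => ((n : ℕ) : ℤ)
  have h3 : ∀ n : Finset.Icc 1 r, ((Rev r 1 r n : ℕ) : ℤ) = (r : ℤ) + 1 - (n : ℕ) := by
    intro n
    have hn := Finset.mem_Icc.1 n.2
    have : Rev r 1 r n = ⟨1 + r - n, Finset.mem_Icc.2 (by omega)⟩ := dif_pos (by omega)
    rw [this]
    simp only
    omega
  simp only [hσ, ← h3, Finset.sum_sub_distrib, Finset.sum_add_distrib] at h1
  rw [h2] at h1
  simp only [Finset.sum_const, Finset.card_univ, Fintype.card_coe, Nat.card_Icc,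
    Nat.add_sub_cancel, nsmul_eq_mul] at h1
  zify
  linarith

/-! ### Identities for powers of `x + y` in characteristic `p` -/

section RingIdentities

variable {R : Type*} [CommRing R] {p : ℕ} [Fact p.Prime] [CharP R p] {x y : R} {e k m : ℕ}

theorem add_pow_char_pow_eq_right {r : ℕ} (hx : x ^ r = 0) (hr : r ≤ p ^ m) :
    (x + y) ^ p ^ m = y ^ p ^ m := by
  rw [add_pow_char_pow, pow_eq_zero_of_le hr hx, zero_add]

theorem add_pow_char_pow_mul (j : ℕ) :
    (x + y) ^ (p ^ e * j) = (x ^ p ^ e + y ^ p ^ e) ^ j := by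
  rw [pow_mul, add_pow_char_pow]

theorem exists_add_pow_char_pow_add (hx : x ^ (p ^ e * k) = 0) (hr : p ^ e * k ≤ p ^ m) :
    ∃ K, (x + y) ^ (p ^ m + p ^ e * k) = y ^ (p ^ m + p ^ e) * K := by
  obtain ⟨K, hK⟩ := Polynomial.powAddExpansion (x ^ p ^ e) (y ^ p ^ e) k
  refine ⟨k * (x ^ p ^ e) ^ (k - 1) + K * y ^ p ^ e, ?_⟩
  rw [pow_add, add_pow_char_pow_eq_right hx hr, add_pow_char_pow_mul, hK, ← pow_mul x, hx, pow_add]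
  ring

theorem exists_add_pow_char_pow_add_succ (hx : x ^ (p ^ e * k) = 0) (hr : p ^ e * k ≤ p ^ m) :
    ∃ K, (x + y) ^ (p ^ m + p ^ e * (k + 1)) = y ^ (p ^ m + 2 * p ^ e) * K := by
  obtain ⟨K, hK⟩ := Polynomial.powAddExpansion (x ^ p ^ e) (y ^ p ^ e) (k + 1)
  refine ⟨K, ?_⟩
  rw [pow_add, add_pow_char_pow_eq_right hx hr, add_pow_char_pow_mul, hK, Nat.add_sub_cancel,
    pow_succ (x ^ p ^ e) k, ← pow_mul x, hx, pow_add, two_mul, pow_add]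
  ring

/-- With `X = x ^ p ^ e` and `Y = y ^ p ^ e`, the factor `X - (k - 1) * Y` is chosen to cancel the
term of `(X + Y) ^ (k - 1)` linear in `Y`; the term free of `Y` becomes `X ^ k = 0`. -/
theorem exists_add_pow_char_pow_add_pred_mul (hk : 2 ≤ k) (hx : x ^ (p ^ e * k) = 0)
    (hr : p ^ e * k ≤ p ^ m) :
    ∃ K, (x + y) ^ (p ^ m + p ^ e * (k - 1)) * (x ^ p ^ e - (k - 1) * y ^ p ^ e) =
      y ^ (p ^ m + 2 * p ^ e) * K := by
  obtain ⟨j, rfl⟩ : ∃ j, k = j + 2 := ⟨k - 2, by omega⟩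
  obtain ⟨K, hK⟩ := Polynomial.powAddExpansion (x ^ p ^ e) (y ^ p ^ e) (j + 1)
  rw [pow_mul] at hx
  refine ⟨K * (x ^ p ^ e - (j + 1) * y ^ p ^ e) - (j + 1) ^ 2 * (x ^ p ^ e) ^ j, ?_⟩
  rw [pow_add, add_pow_char_pow_eq_right (r := p ^ e * (j + 2)) (by rw [pow_mul, hx]) hr,
    show j + 2 - 1 = j + 1 by omega, add_pow_char_pow_mul, hK, Nat.add_sub_cancel, pow_add y,
    two_mul, pow_add y]
  push_cast
  linear_combination (y ^ p ^ m) * hx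

theorem exists_eq_add_mul_of_mul_pow_eq_zero {L i : ℕ} (h : (x + y) ^ L * y ^ i = 0) :
    ∃ w v : R, x ^ i = w + (x + y) * v ∧ (x + y) ^ L * w = 0 := by
  -- Modulo `x + y` one has `x ≡ -y`, so `(-y) ^ i` represents `x ^ i`.
  obtain ⟨v, hv⟩ := sub_dvd_pow_sub_pow x (-y) i
  refine ⟨(-y) ^ i, v, by linear_combination hv, ?_⟩
  rw [neg_pow]
  linear_combination (-1) ^ i * h

/-- Since `y ^ p ^ e ≡ -x ^ p ^ e` modulo `x + y`, the extra factor is congruent to `k * x ^ p ^ e`.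
As `k` is a unit in characteristic `p`, dividing by it gives a representative of `x ^ i`. -/
theorem exists_eq_add_mul_of_mul_sub_mul_pow_eq_zero {L i j : ℕ} (hk : ¬ p ∣ k)
    (hij : i = p ^ e + j)
    (h : (x + y) ^ L * (x ^ p ^ e - (k - 1) * y ^ p ^ e) * y ^ j = 0) :
    ∃ w v : R, x ^ i = w + (x + y) * v ∧ (x + y) ^ L * w = 0 := by
  obtain ⟨c, hc⟩ := ((CharP.isUnit_natCast_iff (R := R) (Fact.out : p.Prime)).2 hk).exists_right_inv
  obtain ⟨v, hv⟩ := sub_dvd_pow_sub_pow x (-y) j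
  obtain ⟨v', hv'⟩ : x + y ∣ x ^ p ^ e + y ^ p ^ e := by
    rw [← add_pow_char_pow]
    exact dvd_pow_self _ (pow_ne_zero _ (Fact.out : p.Prime).ne_zero)
  refine ⟨c * ((-y) ^ j * (x ^ p ^ e - (k - 1) * y ^ p ^ e)),
    c * ((x ^ p ^ e - (k - 1) * y ^ p ^ e) * v + x ^ j * (k - 1) * v'), ?_, ?_⟩
  · rw [hij, pow_add]
    linear_combination (-(x ^ p ^ e * x ^ j)) * hc +
      c * (x ^ p ^ e - (k - 1) * y ^ p ^ e) * hv + c * x ^ j * (k - 1) * hv'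
  · rw [neg_pow]
    linear_combination c * (-1) ^ j * h

end RingIdentities

theorem Rev_apply (r i j : ℕ) (n : Finset.Icc 1 r) :
    (Rev r i j n : ℕ) =
      if 1 ≤ i ∧ j ≤ r ∧ i ≤ (n : ℕ) ∧ (n : ℕ) ≤ j then i + j - n else n := by
  change (revFun r i j n : ℕ) = _
  unfold revFun
  split_ifs <;> rfl

/-- The hypothesis `hσ` serves twice: it supplies the sum condition for
`IsJordanPartition.of_generators` and identifies the Norman permutation. -/
theorem isJordanPartition_and_normanPerm_eq {F : Type u} [Field F] {p : ℕ} [CharP F p] {r s : ℕ}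
    (hr : 0 < r) (hs : 0 < s) (lam : ℕ → ℕ)
    (hanti : ∀ n n', 1 ≤ n → n ≤ n' → n' ≤ r → lam n' ≤ lam n)
    (hpos : ∀ n, 0 < lam n) (σ : Equiv.Perm (Finset.Icc 1 r))
    (hσ : ∀ n, ((σ n : ℕ) : ℤ) = ((r : ℤ) + 1 - (n : ℕ)) + s - lam n)
    (h : ∀ (R : Type u) [CommRing R] [CharP R p] (x y : R), x ^ r = 0 → y ^ s = 0 →
      ∀ n, 1 ≤ n → n ≤ r → ∃ w v : R, x ^ (n - 1) = w + (x + y) * v ∧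
        (x + y) ^ lam n * w = 0) :
    IsJordanPartition F r s (fun n => lam n) ∧ normanPerm F r s = σ := by
  have : IsJordanPartition F r s (fun n => lam n) :=
    IsJordanPartition.of_generators (p := p) hr hs
      (fun n n' hn => hanti n n' (Finset.mem_Icc.1 n.2).1 hn (Finset.mem_Icc.1 n'.2).2)
      (fun n => hpos n) (sum_eq_mul_of_normanPerm _ σ hσ)
      (fun R _ _ x y hx hy n => h R x y hx hy n (Finset.mem_Icc.1 n.2).1 (Finset.mem_Icc.1 n.2).2)
  exact ⟨this, this.normanPerm_eq hσ⟩

/-! ### The three Jordan partitions and their Norman permutations -/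

section NormanPermutations

variable (F : Type u) [Field F] {p : ℕ} [Fact p.Prime] [CharP F p] {e k m b r : ℕ}

theorem normanPerm_add_char_pow (hb : b = p ^ e) (hr : r = b * k) (hk : 2 ≤ k) (hrm : r ≤ p ^ m) :
    normanPerm F r (p ^ m + b) = Rev r 1 b * Rev r (b + 1) r := by
  have hb0 : 0 < b := hb ▸ pow_pos (Fact.out : p.Prime).pos e
  have hbr : 2 * b ≤ r := by rw [hr, mul_comm]; exact Nat.mul_le_mul_left _ hk
  refine (isJordanPartition_and_normanPerm_eq (p := p) (by omega) (by omega)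
    (fun n => if n ≤ b then p ^ m + r else p ^ m) ?_ ?_ _ ?_ ?_).2
  · intro n n' h1 h2 h3
    split_ifs <;> omega
  · intro n
    split_ifs <;> omega
  · intro n
    have hn := Finset.mem_Icc.1 n.2
    rw [Equiv.Perm.mul_apply, Rev_apply, Rev_apply]
    generalize p ^ m = q at *
    split_ifs <;> push_cast <;> omega
  · intro R _ _ x y hx hy n h1 h2
    refine exists_eq_add_mul_of_mul_pow_eq_zero ?_
    split_ifs with h
    · subst hb hr
      obtain ⟨K, hK⟩ := exists_add_pow_char_pow_add (y := y) hx hrm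
      rw [hK, hy, zero_mul, zero_mul]
    · rw [add_pow_char_pow_eq_right hx hrm, ← pow_add]
      exact pow_eq_zero_of_le (by omega) hy

theorem normanPerm_add_two_mul_char_pow (hb : b = p ^ e) (hr : r = b * k) (hk : 2 ≤ k)
    (hpk : ¬ p ∣ k) (hrm : r ≤ p ^ m) (h2b : 2 * b < r) :
    normanPerm F r (p ^ m + 2 * b) =
      Rev r 1 b * Rev r (b + 1) (2 * b) * Rev r (2 * b + 1) r := by
  have hb0 : 0 < b := hb ▸ pow_pos (Fact.out : p.Prime).pos e
  refine (isJordanPartition_and_normanPerm_eq (p := p) (by omega) (by omega)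
    (fun n => if n ≤ b then p ^ m + (r + b) else if n ≤ 2 * b then p ^ m + (r - b) else p ^ m)
    ?_ ?_ _ ?_ ?_).2
  · intro n n' h1 h2 h3
    split_ifs <;> omega
  · intro n
    split_ifs <;> omega
  · intro n
    have hn := Finset.mem_Icc.1 n.2
    rw [Equiv.Perm.mul_apply, Equiv.Perm.mul_apply, Rev_apply, Rev_apply, Rev_apply]
    generalize p ^ m = q at *
    split_ifs <;> push_cast <;> omega
  · intro R _ _ x y hx hy n h1 h2
    split_ifs with h h'
    · refine exists_eq_add_mul_of_mul_pow_eq_zero ?_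
      subst hb hr
      obtain ⟨K, hK⟩ := exists_add_pow_char_pow_add_succ (y := y) hx hrm
      rw [← Nat.mul_succ, Nat.succ_eq_add_one, hK, hy, zero_mul, zero_mul]
    -- For `b < n ≤ 2 * b` a power of `-y` alone is not used; the factor `x ^ b - (k - 1) * y ^ b`
    -- accounts for `b` of the degree `n - 1`.
    · refine exists_eq_add_mul_of_mul_sub_mul_pow_eq_zero (e := e) (j := n - 1 - b) hpk
        (by omega) ?_
      subst hb hr
      obtain ⟨K, hK⟩ := exists_add_pow_char_pow_add_pred_mul (y := y) hk hx hrm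
      rw [← Nat.mul_sub_one, hK, hy, zero_mul, zero_mul]
    · refine exists_eq_add_mul_of_mul_pow_eq_zero ?_
      rw [add_pow_char_pow_eq_right hx hrm, ← pow_add]
      exact pow_eq_zero_of_le (by omega) hy

/-- The `n`-th part of the Jordan partition of `J_r ⊗ J_{q + b + 1}`. -/
def succPart (q r b n : ℕ) : ℕ :=
  if n = 1 then q + (r + b) else if n ≤ b then q + r else if n = b + 1 then q + (r - b) else q

theorem isJordanPartition_succPart (hb : b = p ^ e) (hr : r = b * k) (hk : 2 ≤ k)
    (hpk : ¬ p ∣ k) (hrm : r ≤ p ^ m) :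
    IsJordanPartition F r (p ^ m + b + 1) (fun n => succPart (p ^ m) r b n) ∧
    normanPerm F r (p ^ m + b + 1) = Rev r 2 b * Rev r (b + 2) r := by
  have hb0 : 0 < b := hb ▸ pow_pos (Fact.out : p.Prime).pos e
  have hbr : 2 * b ≤ r := by rw [hr, mul_comm]; exact Nat.mul_le_mul_left _ hk
  refine isJordanPartition_and_normanPerm_eq (p := p) (by omega) (by omega)
    (succPart (p ^ m) r b) ?_ ?_ _ ?_ ?_
  · intro n n' h1 h2 h3
    unfold succPart
    split_ifs <;> omega
  · intro n
    unfold succPart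
    split_ifs <;> omega
  · intro n
    have hn := Finset.mem_Icc.1 n.2
    rw [Equiv.Perm.mul_apply, Rev_apply, Rev_apply, succPart]
    generalize p ^ m = q at *
    split_ifs <;> push_cast <;> omega
  · intro R _ _ x y hx hy n h1 h2
    unfold succPart
    split_ifs with h h' h''
    · refine exists_eq_add_mul_of_mul_pow_eq_zero ?_
      subst hb hr
      obtain ⟨K, hK⟩ := exists_add_pow_char_pow_add_succ (y := y) hx hrm
      -- Here `y ^ (q + b + 1) = 0` already forces `y ^ (q + 2 * b) = 0`, because `1 ≤ b`.
      rw [← Nat.mul_succ, Nat.succ_eq_add_one, hK, pow_eq_zero_of_le (by omega) hy, zero_mul,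
        zero_mul]
    · refine exists_eq_add_mul_of_mul_pow_eq_zero ?_
      subst hb hr
      obtain ⟨K, hK⟩ := exists_add_pow_char_pow_add (y := y) hx hrm
      rw [hK, mul_right_comm, ← pow_add, pow_eq_zero_of_le (by omega) hy, zero_mul]
    · refine exists_eq_add_mul_of_mul_sub_mul_pow_eq_zero (e := e) (j := n - 1 - b) hpk
        (by omega) ?_
      subst hb hr
      obtain ⟨K, hK⟩ := exists_add_pow_char_pow_add_pred_mul (y := y) hk hx hrm
      rw [← Nat.mul_sub_one, hK, pow_eq_zero_of_le (by omega) hy, zero_mul, zero_mul]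
    · refine exists_eq_add_mul_of_mul_pow_eq_zero ?_
      rw [add_pow_char_pow_eq_right hx hrm, ← pow_add]
      exact pow_eq_zero_of_le (by omega) hy

end NormanPermutations

/-! ### Additivity of classes in the Green ring over finite biproducts -/

section GreenRing

variable {F : Type u} {G : Type*} [Field F] [Group G]

theorem greenClass_eq_of_iso {V W : FDRep F G} (i : V ≅ W) : greenClass V = greenClass W := by
  unfold greenClass
  rw [toSkeleton_eq_toSkeleton_iff.2 ⟨i⟩]

theorem greenClass_binaryBicone_pt {V W : FDRep F G} (B : Limits.BinaryBicone V W)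
    (hB : B.IsBilimit) : greenClass B.pt = greenClass V + greenClass W := by
  unfold greenClass
  rw [← map_add, ← sub_eq_zero, ← map_sub, Ideal.Quotient.eq_zero_iff_mem, ← sub_sub]
  exact Ideal.subset_span ⟨V, W, B, ⟨hB⟩, rfl⟩

theorem greenClass_eq_zero_of_isZero {V : FDRep F G} (hV : Limits.IsZero V) :
    greenClass V = 0 := by
  -- A zero object is its own biproduct with itself, so its class satisfies `[V] = [V] + [V]`.
  have h := greenClass_binaryBicone_pt (V := V) (W := V) ⟨V, 𝟙 V, 𝟙 V, 𝟙 V, 𝟙 V,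
    by simp, hV.eq_of_src _ _, hV.eq_of_src _ _, by simp⟩
    (Limits.isBinaryBilimitOfTotal _ (hV.eq_of_src _ _))
  simpa using h

/-- The binary bicone exhibiting `⨁ f` over `Option α` as the biproduct of `f none` and the
biproduct of the remaining summands. -/
noncomputable def optionBiproductBicone {C : Type*} [Category C] [Preadditive C]
    [Limits.HasFiniteBiproducts C] {α : Type} [Fintype α] (f : Option α → C) :
    Limits.BinaryBicone (f none) (⨁ fun a => f (some a)) where
  pt := ⨁ f
  fst := Limits.biproduct.π f none
  snd := Limits.biproduct.lift fun a => Limits.biproduct.π f (some a)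
  inl := Limits.biproduct.ι f none
  inr := Limits.biproduct.desc fun a => Limits.biproduct.ι f (some a)
  inl_fst := by simp
  inl_snd := by
    ext a
    simp
  inr_fst := by
    ext a
    simp
  inr_snd := by
    classical
    ext a b
    simp [Limits.biproduct.ι_π]

theorem optionBiproductBicone_total {C : Type*} [Category C] [Preadditive C]
    [Limits.HasFiniteBiproducts C] {α : Type} [Fintype α] (f : Option α → C) :
    (optionBiproductBicone f).fst ≫ (optionBiproductBicone f).inl +
      (optionBiproductBicone f).snd ≫ (optionBiproductBicone f).inr = 𝟙 _ := by
  change Limits.biproduct.π f none ≫ Limits.biproduct.ι f none +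
    Limits.biproduct.lift (fun a => Limits.biproduct.π f (some a)) ≫
      Limits.biproduct.desc (fun a => Limits.biproduct.ι f (some a)) = 𝟙 (⨁ f)
  rw [Limits.biproduct.lift_desc, ← Limits.biproduct.total, Fintype.sum_option]

theorem greenClass_biproduct [Limits.HasFiniteBiproducts (FDRep F G)] {ι : Type} [Fintype ι]
    (V : ι → FDRep F G) : greenClass (⨁ V) = ∑ n, greenClass (V n) := by
  revert V
  refine Fintype.induction_empty_option (P := fun ι _ => ∀ V : ι → FDRep F G,
    greenClass (⨁ V) = ∑ n, greenClass (V n)) ?_ ?_ ?_ ι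
  · intro α β _ e h V
    let _ := Fintype.ofEquiv β e.symm
    have := h (V ∘ e)
    rw [greenClass_eq_of_iso (Limits.biproduct.reindex e V)] at this
    rw [this]
    exact Equiv.sum_comp e fun n => greenClass (V n)
  · intro V
    rw [Finset.univ_eq_empty, Finset.sum_empty]
    refine greenClass_eq_zero_of_isZero ((Limits.IsZero.iff_id_eq_zero _).2 ?_)
    ext j
    exact j.elim
  · intro α _ h V
    rw [Fintype.sum_option, ← h]
    exact greenClass_binaryBicone_pt (optionBiproductBicone V)
      (Limits.isBinaryBilimitOfTotal _ (optionBiproductBicone_total V))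

theorem greenClass_bicone_pt {ι : Type} [Fintype ι]
    {V : ι → FDRep F G} (B : Limits.Bicone V) (hB : B.IsBilimit) :
    greenClass B.pt = ∑ n, greenClass (V n) := by
  have : Limits.HasFiniteBiproducts (FDRep F G) := Abelian.hasFiniteBiproducts
  rw [← greenClass_biproduct]
  exact greenClass_eq_of_iso (Limits.biproduct.uniqueUpToIso V hB)

end GreenRing

/-! ### From matrices to representations: intertwiners, tensor products, block decompositions -/

section CyclicRep

variable {F : Type u} [Field F] {q : ℕ} [NeZero q] {l m n : Type} [Fintype l] [DecidableEq l]
  [Fintype m] [DecidableEq m] [Fintype n] [DecidableEq n]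

theorem Matrix.mul_pow_eq_pow_mul {A : Matrix m m F} {B : Matrix n n F} {M : Matrix n m F}
    (hM : M * A = B * M) (t : ℕ) : M * A ^ t = B ^ t * M := by
  induction t with
  | zero => rw [pow_zero, pow_zero, Matrix.mul_one, Matrix.one_mul]
  | succ t ih => rw [pow_succ, ← Matrix.mul_assoc, ih, Matrix.mul_assoc, hM, pow_succ,
      Matrix.mul_assoc]

/-- The morphism of representations given by an intertwining matrix. -/
def cyclicRepHom {A : Matrix m m F} {B : Matrix n n F} (hA : A ^ q = 1) (hB : B ^ q = 1)
    (M : Matrix n m F) (hM : M * A = B * M) :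
    FDRep.of (cyclicRep A hA) ⟶ FDRep.of (cyclicRep B hB) where
  hom := FGModuleCat.ofHom (Matrix.toLin' M)
  comm g := by
    apply FGModuleCat.hom_ext
    change Matrix.toLin' M ∘ₗ Matrix.toLin' (A ^ (Multiplicative.toAdd g).val) =
      Matrix.toLin' (B ^ (Multiplicative.toAdd g).val) ∘ₗ Matrix.toLin' M
    rw [← Matrix.toLin'_mul, ← Matrix.toLin'_mul, Matrix.mul_pow_eq_pow_mul hM]

theorem cyclicRepHom_comp {A : Matrix l l F} {B : Matrix m m F} {C : Matrix n n F}
    (hA : A ^ q = 1) (hB : B ^ q = 1) (hC : C ^ q = 1) {M : Matrix m l F} {M' : Matrix n m F}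
    (hM : M * A = B * M) (hM' : M' * B = C * M') :
    cyclicRepHom hA hB M hM ≫ cyclicRepHom hB hC M' hM' =
      cyclicRepHom hA hC (M' * M) (by rw [Matrix.mul_assoc, hM, ← Matrix.mul_assoc, hM',
        Matrix.mul_assoc]) := by
  apply Action.Hom.ext
  apply FGModuleCat.hom_ext
  exact (Matrix.toLin'_mul _ _).symm

theorem cyclicRepHom_one {A : Matrix m m F} (hA : A ^ q = 1) :
    cyclicRepHom hA hA 1 (by rw [Matrix.one_mul, Matrix.mul_one]) = 𝟙 _ := by
  apply Action.Hom.ext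
  apply FGModuleCat.hom_ext
  exact Matrix.toLin'_one

theorem cyclicRepHom_zero {A : Matrix m m F} {B : Matrix n n F} (hA : A ^ q = 1)
    (hB : B ^ q = 1) :
    cyclicRepHom hA hB 0 (by rw [Matrix.zero_mul, Matrix.mul_zero]) = 0 := by
  apply Action.Hom.ext
  apply FGModuleCat.hom_ext
  exact map_zero Matrix.toLin'

theorem cyclicRepHom_sum {ι : Type*} (S : Finset ι) {A : Matrix m m F} {B : Matrix n n F}
    (hA : A ^ q = 1) (hB : B ^ q = 1) (M : ι → Matrix n m F) (hM : ∀ i, M i * A = B * M i) :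
    ∑ i ∈ S, cyclicRepHom hA hB (M i) (hM i) =
      cyclicRepHom hA hB (∑ i ∈ S, M i) (by
        rw [Matrix.sum_mul, Matrix.mul_sum]; exact Finset.sum_congr rfl fun i _ => hM i) := by
  classical
  induction S using Finset.induction_on with
  | empty =>
    simp only [Finset.sum_empty]
    exact (cyclicRepHom_zero hA hB).symm
  | insert i S hi ih =>
    simp only [Finset.sum_insert hi, ih]
    apply Action.Hom.ext
    apply FGModuleCat.hom_ext
    exact (map_add Matrix.toLin' _ _).symm

/-- The tensor product of the representations given by two matrices is the representation given
by their Kronecker product. -/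
noncomputable def cyclicRepTensorIso {A : Matrix m m F} {B : Matrix n n F} (hA : A ^ q = 1)
    (hB : B ^ q = 1) (hAB : (A ⊗ₖ B) ^ q = 1) :
    FDRep.of (cyclicRep A hA) ⊗ FDRep.of (cyclicRep B hB) ≅ FDRep.of (cyclicRep (A ⊗ₖ B) hAB) :=
  Action.mkIso (LinearEquiv.toFGModuleCatIso
    ((Pi.basisFun F m).tensorProduct (Pi.basisFun F n)).equivFun) fun g => by
    apply FGModuleCat.hom_ext
    apply TensorProduct.ext'
    intro x y
    change ((Pi.basisFun F m).tensorProduct (Pi.basisFun F n)).equivFun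
        (((A ^ (Multiplicative.toAdd g).val) *ᵥ x) ⊗ₜ[F]
          ((B ^ (Multiplicative.toAdd g).val) *ᵥ y)) =
      ((A ⊗ₖ B) ^ (Multiplicative.toAdd g).val) *ᵥ
        ((Pi.basisFun F m).tensorProduct (Pi.basisFun F n)).equivFun (x ⊗ₜ[F] y)
    ext ⟨i, j⟩
    rw [kronecker_pow]
    simp only [Module.Basis.equivFun_apply, Module.Basis.tensorProduct_repr_tmul_apply,
      Pi.basisFun_repr, Matrix.mulVec, dotProduct, Matrix.kroneckerMap_apply,
      Fintype.sum_prod_type, smul_eq_mul]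
    rw [mul_comm, Finset.sum_mul_sum]
    refine Finset.sum_congr rfl fun a _ => Finset.sum_congr rfl fun b _ => ?_
    ring

section Blocks

variable {ι : Type} [Fintype ι] [DecidableEq ι] (k : ι → ℕ)

/-- The matrix of the inclusion of the `i`-th block. -/
def blockIncl (F : Type u) [Field F] (i : ι) : Matrix (Σ i, Fin (k i)) (Fin (k i)) F :=
  Matrix.of fun x a => if x = ⟨i, a⟩ then 1 else 0

theorem blockDiagonal'_mul_blockIncl (J : ∀ i, Matrix (Fin (k i)) (Fin (k i)) F) (i : ι) :
    Matrix.blockDiagonal' J * blockIncl k F i = blockIncl k F i * J i := by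
  ext ⟨j, a⟩ c
  rw [Matrix.mul_apply, Matrix.mul_apply, Finset.sum_eq_single ⟨i, c⟩]
  · simp only [blockIncl, Matrix.of_apply, if_true, mul_one]
    by_cases h : j = i
    · subst h
      simp [Matrix.blockDiagonal'_apply_eq]
    · rw [Matrix.blockDiagonal'_apply_ne _ _ _ h]
      simp [h]
  · intro x _ hx
    simp [blockIncl, hx]
  · simp

theorem blockIncl_transpose_mul_blockDiagonal' (J : ∀ i, Matrix (Fin (k i)) (Fin (k i)) F)
    (i : ι) : (blockIncl k F i)ᵀ * Matrix.blockDiagonal' J = J i * (blockIncl k F i)ᵀ := by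
  have := blockDiagonal'_mul_blockIncl k (fun i => (J i)ᵀ) i
  rw [← Matrix.blockDiagonal'_transpose] at this
  simpa using congrArg Matrix.transpose this

theorem blockIncl_transpose_mul_self (i : ι) : (blockIncl k F i)ᵀ * blockIncl k F i = 1 := by
  ext a c
  simp [Matrix.mul_apply, blockIncl, Matrix.one_apply, eq_comm]

theorem blockIncl_transpose_mul_of_ne {i j : ι} (h : i ≠ j) :
    (blockIncl k F j)ᵀ * blockIncl k F i = 0 := by
  ext a c
  simp [Matrix.mul_apply, blockIncl, h]

theorem sum_blockIncl_mul_transpose : ∑ i, blockIncl k F i * (blockIncl k F i)ᵀ = 1 := by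
  ext ⟨j, a⟩ y
  rw [Matrix.sum_apply, Finset.sum_eq_single j]
  · rw [Matrix.mul_apply, Finset.sum_eq_single a]
    · simp [blockIncl, Matrix.one_apply, eq_comm]
    · intro c _ hc
      simp [blockIncl, hc.symm]
    · simp
  · intro i _ hi
    simp [Matrix.mul_apply, blockIncl, hi.symm]
  · simp

end Blocks

/-- The Green ring class of the representation given by a matrix with known Jordan form. -/
theorem greenClass_cyclicRep {ι : Type} [Fintype ι] [DecidableEq ι] {k : ι → ℕ}
    (J : ∀ i, Matrix (Fin (k i)) (Fin (k i)) F) (hJ : ∀ i, J i ^ q = 1) {A : Matrix m m F}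
    (hA : A ^ q = 1) (h : MatrixSimilar A (Matrix.blockDiagonal' J)) :
    greenClass (FDRep.of (cyclicRep A hA)) =
      ∑ i, greenClass (FDRep.of (cyclicRep (J i) (hJ i))) := by
  obtain ⟨P, Q, hPQ, hQP, hB⟩ := h
  have hAP : A * P = P * Matrix.blockDiagonal' J := by
    rw [← hB, ← Matrix.mul_assoc, ← Matrix.mul_assoc, hPQ, Matrix.one_mul]
  have hQA : Q * A = Matrix.blockDiagonal' J * Q := by
    rw [← hB, Matrix.mul_assoc, hPQ, Matrix.mul_one]
  have hι : ∀ i, P * blockIncl k F i * J i = A * (P * blockIncl k F i) := fun i => by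
    rw [← Matrix.mul_assoc, hAP, Matrix.mul_assoc, Matrix.mul_assoc, blockDiagonal'_mul_blockIncl]
  have hπ : ∀ i, (blockIncl k F i)ᵀ * Q * A = J i * ((blockIncl k F i)ᵀ * Q) := fun i => by
    rw [Matrix.mul_assoc, hQA, ← Matrix.mul_assoc, ← Matrix.mul_assoc,
      blockIncl_transpose_mul_blockDiagonal']
  have hπι : ∀ i j, (blockIncl k F j)ᵀ * Q * (P * blockIncl k F i) =
      (blockIncl k F j)ᵀ * blockIncl k F i := fun i j => by
    rw [Matrix.mul_assoc, ← Matrix.mul_assoc Q, hQP, Matrix.one_mul]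
  -- The inclusions are the block columns of `P` and the projections the block rows of `Q`. The
  -- bicone relations express `Q * P = 1`, and totality expresses `P * Q = 1`.
  let B : Limits.Bicone fun i => FDRep.of (cyclicRep (J i) (hJ i)) :=
    { pt := FDRep.of (cyclicRep A hA)
      ι := fun i => cyclicRepHom (hJ i) hA _ (hι i)
      π := fun i => cyclicRepHom hA (hJ i) _ (hπ i)
      ι_π := fun i j => by
        rw [cyclicRepHom_comp]
        split_ifs with hij
        · subst hij
          simp only [hπι, blockIncl_transpose_mul_self]
          exact cyclicRepHom_one (hJ i)
        · simp only [hπι, blockIncl_transpose_mul_of_ne k hij]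
          exact cyclicRepHom_zero (hJ i) (hJ j) }
  refine greenClass_bicone_pt B (Limits.isBilimitOfTotal B ?_)
  change ∑ i, cyclicRepHom hA (hJ i) _ (hπ i) ≫ cyclicRepHom (hJ i) hA _ (hι i) = 𝟙 _
  simp only [cyclicRepHom_comp]
  rw [cyclicRepHom_sum, ← cyclicRepHom_one hA]
  congr 1
  calc ∑ i, P * blockIncl k F i * ((blockIncl k F i)ᵀ * Q)
      = P * (∑ i, blockIncl k F i * (blockIncl k F i)ᵀ) * Q := by
        simp only [Matrix.mul_sum, Matrix.sum_mul, Matrix.mul_assoc]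
    _ = 1 := by rw [sum_blockIncl_mul_transpose, Matrix.mul_one, hPQ]

end CyclicRep

/-! ### Multiplicities of the parts and the final assembly -/

/-- The decomposition of `V_r ⊗ V_s` in the Green ring given by the Jordan partition. -/
theorem IsJordanPartition.greenClass_tensor {F : Type u} [Field F] {p : ℕ} [Fact p.Prime]
    [CharP F p] {N r s : ℕ} {lam : Finset.Icc 1 r → ℕ} (h : IsJordanPartition F r s lam)
    (hr : r ≤ p ^ N) (hs : s ≤ p ^ N) (hlam : ∀ n, lam n ≤ p ^ N) :
    greenClass (jordanRep F r hr ⊗ jordanRep F s hs) =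
      ∑ n, greenClass (jordanRep F (lam n) (hlam n)) := by
  have hrs : (jordanBlock F r ⊗ₖ jordanBlock F s) ^ p ^ N = 1 := by
    rw [kronecker_pow, jordanBlock_pow F hr, jordanBlock_pow F hs, Matrix.one_kronecker_one]
  rw [jordanRep, jordanRep, greenClass_eq_of_iso (cyclicRepTensorIso _ _ hrs)]
  exact greenClass_cyclicRep _ (fun n => jordanBlock_pow F (hlam n)) hrs h.2.2

theorem sum_succPart {M : Type*} [AddCommMonoid M] (g : ℕ → M) {q r b : ℕ} (hb : 0 < b)
    (hbr : b < r) :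
    ∑ n : Finset.Icc 1 r, g (succPart q r b n) =
      g (q + (r + b)) + (b - 1) • g (q + r) + g (q + (r - b)) + (r - b - 1) • g q := by
  rw [Finset.sum_coe_sort (Finset.Icc 1 r) fun n => g (succPart q r b n)]
  have hd : Finset.Icc 1 r = insert 1 (insert (b + 1) (Finset.Icc 2 b ∪ Finset.Icc (b + 2) r)) := by
    ext n
    simp only [Finset.mem_Icc, Finset.mem_insert, Finset.mem_union]
    omega
  rw [hd, Finset.sum_insert, Finset.sum_insert, Finset.sum_union,
    Finset.sum_congr (s₁ := Finset.Icc 2 b) rfl (g := fun _ => g (q + r)),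
    Finset.sum_congr (s₁ := Finset.Icc (b + 2) r) rfl (g := fun _ => g q)]
  · have h1 : succPart q r b 1 = q + (r + b) := if_pos rfl
    have h2 : succPart q r b (b + 1) = q + (r - b) := by
      unfold succPart
      rw [if_neg (by omega), if_neg (by omega), if_pos rfl]
    rw [h1, h2, Finset.sum_const, Finset.sum_const, Nat.card_Icc, Nat.card_Icc,
      show b + 1 - 2 = b - 1 by omega, show r + 1 - (b + 2) = r - b - 1 by omega]
    abel
  · intro n hn
    rw [Finset.mem_Icc] at hn
    unfold succPart
    rw [if_neg (by omega), if_neg (by omega), if_neg (by omega)]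
  · intro n hn
    rw [Finset.mem_Icc] at hn
    unfold succPart
    rw [if_neg (by omega), if_pos (by omega)]
  · rw [Finset.disjoint_left]
    intro n h1 h2
    rw [Finset.mem_Icc] at h1 h2
    omega
  · simp only [Finset.mem_Icc, Finset.mem_union]
    omega
  · simp only [Finset.mem_Icc, Finset.mem_insert, Finset.mem_union]
    omega

theorem mainTheorem9 (p : ℕ) [Fact p.Prime] (F : Type*) [Field F] [CharP F p] (r b m : ℕ)
    (hb : b = p ^ padicValNat p r) (hb1 : 1 < b) (hbr : b < r) (hrm : r ≤ p ^ m) :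
    normanPerm F r (p ^ m + b) = Rev r 1 b * Rev r (b + 1) r ∧
    (2 * b < r →
      normanPerm F r (p ^ m + 2 * b) =
        Rev r 1 b * Rev r (b + 1) (2 * b) * Rev r (2 * b + 1) r) ∧
    normanPerm F r (p ^ m + b + 1) = Rev r 2 b * Rev r (b + 2) r ∧
    ∀ (N : ℕ) (hN : p ^ m + r + b ≤ p ^ N),
      greenClass (jordanRep F r (show r ≤ p ^ N by omega) ⊗
          jordanRep F (p ^ m + b + 1) (show p ^ m + b + 1 ≤ p ^ N by omega)) =
        greenClass (jordanRep F (p ^ m + r + b) (show p ^ m + r + b ≤ p ^ N by omega))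
          + (b - 1) • greenClass (jordanRep F (p ^ m + r) (show p ^ m + r ≤ p ^ N by omega))
          + greenClass (jordanRep F (p ^ m + r - b) (show p ^ m + r - b ≤ p ^ N by omega))
          + (r - b - 1) • greenClass (jordanRep F (p ^ m) (show p ^ m ≤ p ^ N by omega)) := by
  have hp : p.Prime := Fact.out
  obtain ⟨k, hk⟩ : b ∣ r := hb ▸ pow_padicValNat_dvd
  have hk2 : 2 ≤ k := by
    by_contra! hlt
    have : b * k ≤ b * 1 := Nat.mul_le_mul_left b (by omega)
    omega
  -- `b` is the full `p`-part of `r`, so the cofactor `k` is prime to `p`.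
  have hpk : ¬ p ∣ k := by
    rintro ⟨j, rfl⟩
    refine pow_succ_padicValNat_not_dvd (p := p) (n := r) (by omega) ⟨j, ?_⟩
    rw [pow_succ, ← hb, mul_assoc]
    exact hk
  obtain ⟨hJ, hperm⟩ := isJordanPartition_succPart F hb hk hk2 hpk hrm
  refine ⟨normanPerm_add_char_pow F hb hk hk2 hrm,
    normanPerm_add_two_mul_char_pow F hb hk hk2 hpk hrm, hperm, fun N hN => ?_⟩
  rw [hJ.greenClass_tensor _ _ fun n => by unfold succPart; split_ifs <;> omega]
  -- Extending by `0` beyond `p ^ N` frees the class from its bound proof, so that indices can be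
  -- rewritten; every index that occurs is at most `p ^ N`.
  set g : ℕ → GreenRing F (Multiplicative (ZMod (p ^ N))) := fun j =>
    if h : j ≤ p ^ N then greenClass (jordanRep F j h) else 0
  have hg : ∀ j (h : j ≤ p ^ N), greenClass (jordanRep F j h) = g j := fun j h => by
    simp only [g, dif_pos h]
  simp only [hg]
  rw [sum_succPart g (by omega) hbr, ← add_assoc, Nat.add_sub_assoc hbr.le]
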